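/- Let $k$ be a field and let $R = k[x_1,\dots,x_d]$ be the polynomial ring with its standard grading. Let $I = (G)$ be the principal ideal generated by a nonzero form $G \in R$ of degree $\gamma$, and let $F = f_1,\dots,f_d$ be a regular sequence of forms of $R$, all of the same degree $\delta$. Assume that neither $\delta$ nor $\delta+\gamma$ is $0$ in $k$. Let $GF$ denote the sequence $Gf_1,\dots,Gf_d$, let $J = (Gf_1,\dots,Gf_d)$, and let $\mathrm{Jac}(GF) = \bigl(\partial (Gf_i)/\partial x_j\bigr)_{1\le i,j\le d}$ be its Jacobian matrix. Then the socle of $R/I^{d-1}J$, that is, the submodule of all elements annihilated by the maximal ideal $(x_1,\dots,x_d)$, is generated by the residue class of $\det \mathrm{Jac}(GF)$. -/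

import Mathlib

namespace JacobianSocle

/-- The homogeneous maximal ideal `(x₁, …, x_d)` of `k[x₁, …, x_d]`. -/
noncomputable def irrelevantIdeal (k : Type*) [Field k] (d : ℕ) : Ideal (MvPolynomial (Fin d) k) :=
  Ideal.span (Set.range (MvPolynomial.X : Fin d → MvPolynomial (Fin d) k))

/-- The socle of a module `M` over `k[x₁, …, x_d]`: the submodule of all elements of `M` that are
annihilated by the homogeneous maximal ideal `(x₁, …, x_d)`. -/
noncomputable def socle (k : Type*) [Field k] (d : ℕ) (M : Type*) [AddCommGroup M]
    [Module (MvPolynomial (Fin d) k) M] : Submodule (MvPolynomial (Fin d) k) M :=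
  Submodule.torsionBySet (MvPolynomial (Fin d) k) M
    (irrelevantIdeal k d : Set (MvPolynomial (Fin d) k))

/-- The Jacobian matrix of a sequence of `d` polynomials in `d` variables, with entry
`∂fᵢ/∂xⱼ` in row `i` and column `j`. -/
noncomputable def jac {k : Type*} [Field k] {d : ℕ} (f : Fin d → MvPolynomial (Fin d) k) :
    Matrix (Fin d) (Fin d) (MvPolynomial (Fin d) k) :=
  Matrix.of fun i j => MvPolynomial.pderiv j (f i)

end JacobianSocle

/-! Since `I ^ (d - 1) * J` equals `(G ^ d) * (F)`, for `d ≥ 2` the variables can multiply `a` into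
it only if `G ^ d ∣ a`, and cancelling `G ^ d` reduces the claim to the colon ideal `(F) : (x)`.
Euler's formula writes `F = A x` with `A = δ⁻¹ Jac F`, and for a regular sequence of this form `(F)
: (x) = (F) + (det A)` (`mem_sup_span_det_of_mul_mem`, `mul_det_mem`). Finally `det Jac(GF)` is a
unit times `G ^ d * det Jac F` (`det_jac_mul`).

The colon formula is proved in the exterior algebra of `R ^ n`: contracting with the rows of `A`
sends the vector `x` to the entries of `F`, and contracting with all of them yields multiples of
`det A`. -/

namespace JacobianSocle

open CliffordAlgebra ExteriorAlgebra

/-! ### Exactness of multiplication by a vector in the exterior algebra -/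

section Koszul

variable {R M : Type*} [CommRing R] [AddCommGroup M] [Module R M]

local notation "Λ" => ExteriorAlgebra R M

/-- Contraction of the exterior algebra against a linear form. -/
noncomputable def contract (d : Module.Dual R M) : Module.End R (ExteriorAlgebra R M) :=
  CliffordAlgebra.contractLeft (Q := (0 : QuadraticForm R M)) d

theorem contract_ι_mul (d : Module.Dual R M) (v : M) (b : Λ) :
    contract d (ExteriorAlgebra.ι R v * b) = d v • b - ExteriorAlgebra.ι R v * contract d b :=
  CliffordAlgebra.contractLeft_ι_mul d v b

theorem contract_algebraMap (d : Module.Dual R M) (r : R) :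
    contract d (algebraMap R Λ r) = 0 :=
  CliffordAlgebra.contractLeft_algebraMap _ d r

theorem contract_contract (d : Module.Dual R M) (b : Λ) : contract d (contract d b) = 0 :=
  CliffordAlgebra.contractLeft_contractLeft d b

theorem contract_eq_zero_of_mem_zero (d : Module.Dual R M) {b : Λ} (hb : b ∈ ⋀[R]^0 M) :
    contract d b = 0 := by
  rw [exteriorPower, pow_zero, Submodule.mem_one] at hb
  obtain ⟨r, rfl⟩ := hb
  exact contract_algebraMap d r

theorem ι_mul_mem {p : ℕ} (v : M) {b : Λ} (hb : b ∈ ⋀[R]^p M) :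
    ExteriorAlgebra.ι R v * b ∈ ⋀[R]^(p + 1) M := by
  rw [exteriorPower, pow_succ']
  exact Submodule.mul_mem_mul (LinearMap.mem_range_self _ v) hb

theorem contract_mem (d : Module.Dual R M) (p : ℕ) :
    ∀ b ∈ ⋀[R]^(p + 1) M, contract d b ∈ ⋀[R]^p M := by
  induction p with
  | zero =>
    intro b hb
    rw [exteriorPower, zero_add, pow_one] at hb
    obtain ⟨v, rfl⟩ := hb
    rw [← mul_one (ExteriorAlgebra.ι R v), contract_ι_mul, ← map_one (algebraMap R Λ),
      contract_algebraMap, mul_zero, sub_zero]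
    exact Submodule.smul_mem _ _ (by rw [exteriorPower, pow_zero, map_one]; exact Submodule.one_le.1 le_rfl)
  | succ p ih =>
    intro b hb
    rw [exteriorPower, pow_succ'] at hb
    induction hb using Submodule.mul_induction_on' with
    | mem_mul_mem x hx y hy =>
      obtain ⟨v, rfl⟩ := hx
      rw [contract_ι_mul]
      exact sub_mem (Submodule.smul_mem _ _ hy) (ι_mul_mem v (ih y hy))
    | add x _ y _ hx hy => rw [map_add]; exact add_mem hx hy

theorem ι_mul_ι_mul (v : M) (b : Λ) : ExteriorAlgebra.ι R v * (ExteriorAlgebra.ι R v * b) = 0 := by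
  rw [← mul_assoc, ExteriorAlgebra.ι_sq_zero, zero_mul]

theorem map_mem_smul_top {N N' : Type*} [AddCommGroup N] [Module R N] [AddCommGroup N'] [Module R N']
    (T : N →ₗ[R] N') {K : Ideal R} {z : N}
    (hz : z ∈ K • (⊤ : Submodule R N)) : T z ∈ K • (⊤ : Submodule R N') := by
  have := Submodule.mem_map_of_mem (f := T) hz
  rw [Submodule.map_smul''] at this
  exact Submodule.smul_mono le_rfl le_top this

theorem mem_sup_span_singleton_smul_top {N : Type*} [AddCommGroup N] [Module R N] {K : Ideal R}
    {r : R} {z : N} :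
    z ∈ (K ⊔ Ideal.span {r}) • (⊤ : Submodule R N) ↔
      ∃ t : N, z - r • t ∈ K • (⊤ : Submodule R N) := by
  rw [Submodule.sup_smul, Submodule.mem_sup]
  constructor
  · rintro ⟨y, hy, w, hw, rfl⟩
    rw [Submodule.ideal_span_singleton_smul, Submodule.mem_smul_pointwise_iff_exists] at hw
    obtain ⟨t, -, rfl⟩ := hw
    exact ⟨t, by simpa using hy⟩
  · rintro ⟨t, ht⟩
    exact ⟨_, ht, r • t, Submodule.smul_mem_smul (Ideal.mem_span_singleton_self r) trivial,
      sub_add_cancel _ _⟩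

/-- The composite of the first `m` contractions. -/
noncomputable def contractIter (d : ℕ → Module.Dual R M) : ℕ → Module.End R (ExteriorAlgebra R M)
  | 0 => 1
  | m + 1 => contract (d m) * contractIter d m

variable {n : ℕ} {ξ : M} {d : ℕ → Module.Dual R M} {K : ℕ → Ideal R}

/-- Multiplication by `ξ` is exact in low degrees modulo an initial part of a regular sequence
consisting of values `d i ξ`. -/
theorem exists_sub_ι_mul_mem_of_ι_mul_mem
    (hK : ∀ m < n, K (m + 1) = K m ⊔ Ideal.span {d m ξ})
    (hreg : ∀ m < n, ∀ z : Λ, d m ξ • z ∈ K m • (⊤ : Submodule R Λ) →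
      z ∈ K m • (⊤ : Submodule R Λ)) (j : ℕ) :
    ∀ m, m + j = n → ∀ p < j, ∀ b ∈ ⋀[R]^p M,
      ExteriorAlgebra.ι R ξ * b ∈ K m • (⊤ : Submodule R Λ) →
        ∃ w, b - ExteriorAlgebra.ι R ξ * w ∈ K m • (⊤ : Submodule R Λ) := by
  induction j with
  | zero => intro m _ p hp; omega
  | succ j ih =>
    intro m hm p hp b hb hξb
    have hmn : m < n := by omega
    -- Contracting `ξ ∧ b` trades a relation modulo `K m` for one modulo `K (m + 1)` in degree one
    -- lower.
    have key : d m ξ • b - ExteriorAlgebra.ι R ξ * contract (d m) b ∈ K m • (⊤ : Submodule R Λ) := by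
      rw [← contract_ι_mul]
      exact map_mem_smul_top _ hξb
    rcases p with _ | p
    · refine ⟨0, ?_⟩
      rw [contract_eq_zero_of_mem_zero _ hb, mul_zero, sub_zero] at key
      simpa using hreg m hmn b key
    · have hu : ExteriorAlgebra.ι R ξ * contract (d m) b ∈ K (m + 1) • (⊤ : Submodule R Λ) := by
        rw [hK m hmn, mem_sup_span_singleton_smul_top]
        exact ⟨b, by rw [← neg_sub]; exact neg_mem key⟩
      obtain ⟨s, hs⟩ := ih (m + 1) (by omega) p (by omega) _ (contract_mem _ _ b hb) hu
      rw [hK m hmn, mem_sup_span_singleton_smul_top] at hs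
      obtain ⟨t, ht⟩ := hs
      refine ⟨t, hreg m hmn _ ?_⟩
      have := add_mem key (map_mem_smul_top (LinearMap.mulLeft R (ExteriorAlgebra.ι R ξ)) ht)
      convert this using 1
      simp only [LinearMap.mulLeft_apply, mul_sub, ι_mul_ι_mul, smul_sub, mul_smul_comm]
      abel

/-- This is the critical degree `p = n - m`, where exactness fails: the extra cycles come from the
iterated contractions. Dividing `ξ ∧ b` by `d m ξ` modulo `K m` gives a cycle `b'` one degree
higher, to which induction applies; contracting it recovers `b` up to multiples of `ξ` and `K (m +
1)`. -/
theorem exists_sub_contractIter_mem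
    (hK : ∀ m < n, K (m + 1) = K m ⊔ Ideal.span {d m ξ})
    (hreg : ∀ m < n, ∀ z : Λ, d m ξ • z ∈ K m • (⊤ : Submodule R Λ) →
      z ∈ K m • (⊤ : Submodule R Λ)) (m : ℕ) :
    ∀ p, p + m = n → ∀ b ∈ ⋀[R]^p M,
      ExteriorAlgebra.ι R ξ * b ∈ K m • (⊤ : Submodule R Λ) →
        ∃ c w, b - contractIter d m c - ExteriorAlgebra.ι R ξ * w ∈ K m • (⊤ : Submodule R Λ) := by
  induction m with
  | zero => exact fun p _ b _ _ => ⟨b, 0, by simp [contractIter]⟩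
  | succ m ih =>
    intro p hp b hb hξb
    have hmn : m < n := by omega
    obtain ⟨b', hb', hs⟩ : ∃ b' ∈ ⋀[R]^(p + 1) M,
        ExteriorAlgebra.ι R ξ * b - d m ξ • b' ∈ K m • (⊤ : Submodule R Λ) := by
      have h := hξb
      rw [hK m hmn, mem_sup_span_singleton_smul_top] at h
      obtain ⟨b₀, hb₀⟩ := h
      -- The quotient `b₀` need not be homogeneous; its component of degree `p + 1` serves equally
      -- well.
      let π : Λ →ₗ[R] Λ := GradedAlgebra.proj (fun i : ℕ => ⋀[R]^i M) (p + 1)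
      refine ⟨π b₀, SetLike.coe_mem (DirectSum.decompose (fun i : ℕ => ⋀[R]^i M) b₀ (p + 1)), ?_⟩
      have h1 : π (ExteriorAlgebra.ι R ξ * b) = ExteriorAlgebra.ι R ξ * b :=
        DirectSum.decompose_of_mem_same (fun i : ℕ => ⋀[R]^i M) (ι_mul_mem ξ hb)
      have h2 := map_mem_smul_top π hb₀
      rwa [map_sub, map_smul, h1] at h2
    have hξb' : ExteriorAlgebra.ι R ξ * b' ∈ K m • (⊤ : Submodule R Λ) := by
      refine hreg m hmn _ ?_
      have := neg_mem (map_mem_smul_top (LinearMap.mulLeft R (ExteriorAlgebra.ι R ξ)) hs)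
      simpa [mul_sub, ι_mul_ι_mul] using this
    obtain ⟨c, w, hcw⟩ := ih (p + 1) (by omega) b' hb' hξb'
    have key : d m ξ • (b - contract (d m) b') - ExteriorAlgebra.ι R ξ * contract (d m) b ∈
        K m • (⊤ : Submodule R Λ) := by
      have := map_mem_smul_top (contract (d m)) hs
      rw [map_sub, contract_ι_mul, map_smul] at this
      convert this using 1
      rw [smul_sub]; abel
    obtain ⟨s, t, hst⟩ : ∃ s t, contract (d m) b - ExteriorAlgebra.ι R ξ * s - d m ξ • t ∈
        K m • (⊤ : Submodule R Λ) := by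
      rcases p with _ | p
      · exact ⟨0, 0, by simp [contract_eq_zero_of_mem_zero _ hb]⟩
      · have hu : ExteriorAlgebra.ι R ξ * contract (d m) b ∈ K (m + 1) • (⊤ : Submodule R Λ) := by
          rw [hK m hmn, mem_sup_span_singleton_smul_top]
          exact ⟨_, by rw [← neg_sub]; exact neg_mem key⟩
        obtain ⟨s, hs⟩ := exists_sub_ι_mul_mem_of_ι_mul_mem hK hreg (p + 1) (m + 1) (by omega) p
          (by omega) _ (contract_mem _ _ b hb) hu
        rw [hK m hmn, mem_sup_span_singleton_smul_top] at hs
        exact ⟨s, hs⟩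
    have hbt : b - contract (d m) b' - ExteriorAlgebra.ι R ξ * t ∈ K m • (⊤ : Submodule R Λ) := by
      refine hreg m hmn _ ?_
      have := add_mem key (map_mem_smul_top (LinearMap.mulLeft R (ExteriorAlgebra.ι R ξ)) hst)
      convert this using 1
      simp only [LinearMap.mulLeft_apply, mul_sub, ι_mul_ι_mul, smul_sub, mul_smul_comm]
      abel
    -- Contracting `ξ ∧ w` gives `d m ξ • w - ξ ∧ contract (d m) w`; the first term is absorbed by
    -- `K (m + 1)`.
    refine ⟨c, t - contract (d m) w, ?_⟩
    rw [hK m hmn, mem_sup_span_singleton_smul_top]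
    refine ⟨w, ?_⟩
    have := add_mem hbt (map_mem_smul_top (contract (d m)) hcw)
    convert this using 1
    simp only [contractIter, Module.End.mul_apply, map_sub, contract_ι_mul, mul_sub]
    abel

end Koszul

end JacobianSocle

namespace JacobianSocle

/-! ### The colon ideal of a regular sequence `A x` by `x` -/

section Colon

variable {R M : Type*} [CommRing R] [AddCommGroup M] [Module R M]

theorem contractIter_eq_prod (d : ℕ → Module.Dual R M) (m : ℕ) :
    contractIter d m = (List.ofFn fun i : Fin m => contract (d (m - 1 - i))).prod := by
  induction m with
  | zero => simp [contractIter]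
  | succ m ih =>
    rw [contractIter, List.ofFn_succ, List.prod_cons, ih]
    congr 4
    funext i
    congr 2
    simp only [Fin.val_succ]
    omega

/-- The action of the exterior algebra of the dual by iterated contraction. -/
noncomputable def contractAlgHom (R M : Type*) [CommRing R] [AddCommGroup M] [Module R M] :
    ExteriorAlgebra R (Module.Dual R M) →ₐ[R] Module.End R (ExteriorAlgebra R M) :=
  ExteriorAlgebra.lift R ⟨CliffordAlgebra.contractLeft (Q := (0 : QuadraticForm R M)),
    fun d => LinearMap.ext fun b => contract_contract d b⟩

theorem contractAlgHom_ιMulti {n : ℕ} (v : Fin n → Module.Dual R M) :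
    contractAlgHom R M (ExteriorAlgebra.ιMulti R n v) = (List.ofFn fun i => contract (v i)).prod := by
  rw [ExteriorAlgebra.ιMulti_apply, map_list_prod, List.map_ofFn]
  congr 2
  funext i
  exact ExteriorAlgebra.lift_ι_apply R _ _ _

/-- Contractions square to zero, so the scalar part is an alternating `n`-form in the rows of `A`,
hence a multiple of the determinant. The last contraction stands leftmost, so the rows appear
reversed; the resulting sign goes into `r`. -/
theorem exists_algebraMapInv_contractIter {n : ℕ} (A : Matrix (Fin n) (Fin n) R)
    (d : ℕ → Module.Dual R (Fin n → R)) (hd : ∀ i : Fin n, d i = dotProductBilin R R (A i))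
    (c : ExteriorAlgebra R (Fin n → R)) :
    ∃ r, ExteriorAlgebra.algebraMapInv (contractIter d n c) = r * A.det := by
  let ε : Module.End R (ExteriorAlgebra R (Fin n → R)) →ₗ[R] R :=
    ExteriorAlgebra.algebraMapInv.toLinearMap ∘ₗ LinearMap.applyₗ c
  let Φ : (Fin n → R) [⋀^Fin n]→ₗ[R] R :=
    ((ε ∘ₗ (contractAlgHom R (Fin n → R)).toLinearMap).compAlternatingMap
      (ExteriorAlgebra.ιMulti R n)).compLinearMap (dotProductBilin R R)
  have hΦ : ExteriorAlgebra.algebraMapInv (contractIter d n c) = Φ fun i => A (Fin.revPerm i) := by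
    have : contractIter d n =
        contractAlgHom R _ (ExteriorAlgebra.ιMulti R n fun i => dotProductBilin R R (A (Fin.revPerm i))) := by
      rw [contractAlgHom_ιMulti, contractIter_eq_prod]
      congr 2
      funext i
      rw [← hd]
      congr 2
      simp only [Fin.revPerm_apply, Fin.val_rev]
      omega
    rw [this]
    rfl
  have hdet : (Pi.basisFun R (Fin n)).det (fun i => A (Fin.revPerm i)) =
      Equiv.Perm.sign (Fin.revPerm (n := n)) * A.det := by
    rw [← Matrix.det_permute, Pi.basisFun_det]
    rfl
  rw [hΦ, Φ.eq_smul_basis_det (Pi.basisFun R (Fin n)), AlternatingMap.smul_apply, hdet, smul_eq_mul,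
    ← mul_assoc]
  exact ⟨_, rfl⟩

theorem mem_of_smul_mem_of_isWeaklyRegular {N : Type*} [AddCommGroup N] [Module R N] [Module.Flat R N]
    {rs : List R} (h : RingTheory.Sequence.IsWeaklyRegular R rs) {m : ℕ} (hm : m < rs.length) {z : N}
    (hz : rs[m] • z ∈ Ideal.ofList (rs.take m) • (⊤ : Submodule R N)) :
    z ∈ Ideal.ofList (rs.take m) • (⊤ : Submodule R N) := by
  have hN : RingTheory.Sequence.IsWeaklyRegular N rs :=
    ((TensorProduct.lid R N).isWeaklyRegular_congr rs).1 h.isWeaklyRegular_rTensor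
  have := hN.regular_mod_prev m hm
  rw [← Submodule.Quotient.mk_eq_zero] at hz ⊢
  refine this ?_
  simpa using hz

/-- If the regular sequence `A x` is expressed through `x`, then every element multiplying `x` into
the ideal generated by `A x` lies in that ideal up to a multiple of `det A`. -/
theorem mem_sup_span_det_of_mul_mem {n : ℕ} (A : Matrix (Fin n) (Fin n) R) (x : Fin n → R)
    (h : RingTheory.Sequence.IsWeaklyRegular R (List.ofFn (A.mulVec x))) (a : R)
    (ha : ∀ j, x j * a ∈ Ideal.span (Set.range (A.mulVec x))) :
    a ∈ Ideal.span (Set.range (A.mulVec x)) ⊔ Ideal.span {A.det} := by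
  have hflat : Module.Flat R (ExteriorAlgebra R (Fin n → R)) :=
    have := Module.Free.of_basis (Pi.basisFun R (Fin n)).ExteriorAlgebra
    inferInstance
  set rs := List.ofFn (A.mulVec x) with hrs
  have hlen : rs.length = n := List.length_ofFn
  let d : ℕ → Module.Dual R (Fin n → R) := fun i =>
    if hi : i < n then dotProductBilin R R (A ⟨i, hi⟩) else 0
  let K : ℕ → Ideal R := fun m => Ideal.ofList (rs.take m)
  have hd : ∀ i : Fin n, d i = dotProductBilin R R (A i) := fun i => by simp [d]
  have hdx : ∀ m (hm : m < n), d m x = rs[m]'(by omega) := fun m hm => by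
    rw [hd ⟨m, hm⟩]
    simp [hrs, Matrix.mulVec]
  have hK : ∀ m < n, K (m + 1) = K m ⊔ Ideal.span {d m x} := fun m hm => by
    rw [hdx m hm, ← Ideal.ofList_singleton, ← Ideal.ofList_append, List.take_append_getElem]
  have hKn : K n = Ideal.span (Set.range (A.mulVec x)) := by
    simp only [K, ← hlen, List.take_length, Ideal.ofList]
    congr 1
    ext r
    simp [hrs, List.mem_ofFn]
  have hreg : ∀ m < n, ∀ z : ExteriorAlgebra R (Fin n → R),
      d m x • z ∈ K m • (⊤ : Submodule R (ExteriorAlgebra R (Fin n → R))) →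
      z ∈ K m • (⊤ : Submodule R (ExteriorAlgebra R (Fin n → R))) := fun m hm z hz =>
    mem_of_smul_mem_of_isWeaklyRegular h (by omega) (by rwa [hdx m hm] at hz)
  have hξ : ExteriorAlgebra.ι R x * algebraMap R _ a ∈
      K n • (⊤ : Submodule R (ExteriorAlgebra R (Fin n → R))) := by
    rw [← Algebra.commutes, ← Algebra.smul_def, ← map_smul]
    refine map_mem_smul_top _ ?_
    rw [pi_eq_sum_univ' (a • x)]
    refine sum_mem fun j _ => Submodule.smul_mem_smul ?_ trivial
    rw [hKn, Pi.smul_apply, smul_eq_mul, mul_comm]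
    exact ha j
  -- The case `m = n`, `p = 0`; projecting to scalars then kills the term `ξ ∧ w`.
  obtain ⟨c, w, hcw⟩ := exists_sub_contractIter_mem hK hreg n 0 (zero_add n) (algebraMap R _ a)
    (by rw [ExteriorAlgebra.exteriorPower, pow_zero]; exact Submodule.algebraMap_mem a) hξ
  obtain ⟨r, hr⟩ := exists_algebraMapInv_contractIter A d hd c
  have key := map_mem_smul_top ExteriorAlgebra.algebraMapInv.toLinearMap hcw
  rw [AlgHom.toLinearMap_apply, map_sub, map_sub, hr, map_mul,
    ExteriorAlgebra.algebraMap_leftInverse, hKn, smul_eq_mul, Ideal.mul_top,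
    show ExteriorAlgebra.algebraMapInv (ExteriorAlgebra.ι R x) = 0 by
      simp [ExteriorAlgebra.algebraMapInv], zero_mul, sub_zero] at key
  exact Submodule.mem_sup.2 ⟨_, key, r * A.det,
    Ideal.mul_mem_left _ _ (Ideal.mem_span_singleton_self _), sub_add_cancel _ _⟩

/-- Cramer's rule: the adjugate of `A` applied to `A x` is `det A • x`. -/
theorem mul_det_mem {n : ℕ} (A : Matrix (Fin n) (Fin n) R) (x : Fin n → R) (j : Fin n) :
    x j * A.det ∈ Ideal.span (Set.range (A.mulVec x)) := by
  have : x j * A.det = (A.adjugate.mulVec (A.mulVec x)) j := by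
    rw [Matrix.mulVec_mulVec, Matrix.adjugate_mul, Matrix.smul_mulVec, Matrix.one_mulVec,
      Pi.smul_apply, smul_eq_mul, mul_comm]
  rw [this, Matrix.mulVec, dotProduct]
  exact sum_mem fun i _ => Ideal.mul_mem_left _ _ (Ideal.subset_span (Set.mem_range_self i))

end Colon

end JacobianSocle

namespace JacobianSocle

/-! ### Jacobian determinants and socles -/

section Jacobian

open MvPolynomial

variable {k : Type*} [Field k] {d : ℕ}

theorem jac_mulVec_X {F : Fin d → MvPolynomial (Fin d) k} {e : ℕ} (hF : ∀ i, (F i).IsHomogeneous e) :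
    (jac F).mulVec X = C (σ := Fin d) (e : k) • F := by
  funext i
  have := (hF i).sum_X_mul_pderiv
  simp only [Matrix.mulVec, dotProduct, jac, Matrix.of_apply, Pi.smul_apply, smul_eq_mul]
  rw [map_natCast, ← nsmul_eq_mul, ← this]
  exact Finset.sum_congr rfl fun j _ => mul_comm _ _

theorem smul_jac_mulVec_X {F : Fin d → MvPolynomial (Fin d) k} {e : ℕ}
    (hF : ∀ i, (F i).IsHomogeneous e) (he : (e : k) ≠ 0) :
    (C (σ := Fin d) (e : k)⁻¹ • jac F).mulVec X = F := by
  rw [Matrix.smul_mulVec, jac_mulVec_X hF, smul_smul, ← map_mul, inv_mul_cancel₀ he, map_one,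
    one_smul]

theorem forall_X_mul_mem_iff {F : Fin d → MvPolynomial (Fin d) k} {e : ℕ}
    (hF : ∀ i, (F i).IsHomogeneous e) (he : (e : k) ≠ 0)
    (hreg : RingTheory.Sequence.IsWeaklyRegular (MvPolynomial (Fin d) k) (List.ofFn F))
    (a : MvPolynomial (Fin d) k) :
    (∀ j, X j * a ∈ Ideal.span (Set.range F)) ↔
      a ∈ Ideal.span (Set.range F) ⊔ Ideal.span {(jac F).det} := by
  have hA := smul_jac_mulVec_X hF he
  have hdet : Ideal.span {(C (σ := Fin d) (e : k)⁻¹ • jac F).det} = Ideal.span {(jac F).det} := by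
    rw [Matrix.det_smul]
    exact Ideal.span_singleton_mul_left_unit
      (((IsUnit.mk0 _ (inv_ne_zero he)).map C).pow _) _
  constructor
  · intro h
    rw [← hdet]
    have := mem_sup_span_det_of_mul_mem (C (σ := Fin d) (e : k)⁻¹ • jac F) X (by rwa [hA]) a (by rwa [hA])
    rwa [hA] at this
  · rw [← hdet]
    intro h j
    obtain ⟨y, hy, z, hz, rfl⟩ := Submodule.mem_sup.1 h
    obtain ⟨r, rfl⟩ := Ideal.mem_span_singleton'.1 hz
    have := mul_det_mem (C (σ := Fin d) (e : k)⁻¹ • jac F) X j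
    rw [hA] at this
    rw [mul_add, mul_left_comm]
    exact add_mem (Ideal.mul_mem_left _ _ hy) (Ideal.mul_mem_left _ _ this)

/-- The value at `g` of the characteristic polynomial of the rank-one matrix `-u vᵀ`. -/
theorem det_scalar_add_vecMulVec {R : Type*} [CommRing R] (hd : 0 < d) (g : R) (u v : Fin d → R) :
    (Matrix.scalar (Fin d) g + Matrix.vecMulVec u v).det = g ^ (d - 1) * (g + u ⬝ᵥ v) := by
  have h := Matrix.eval_charpoly (Matrix.vecMulVec (-u) v) g
  rw [Matrix.neg_vecMulVec, sub_neg_eq_add] at h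
  rw [← h, ← Matrix.neg_vecMulVec, Matrix.charpoly_vecMulVec]
  obtain ⟨d, rfl⟩ := Nat.exists_eq_succ_of_ne_zero hd.ne'
  simp [pow_succ]
  ring

/-- The Leibniz rule, with `F` replaced by `δ⁻¹ Jac F · x` so that `Jac F` factors out. -/
theorem jac_mul_eq {G : MvPolynomial (Fin d) k} {F : Fin d → MvPolynomial (Fin d) k} {e : ℕ}
    (hF : ∀ i, (F i).IsHomogeneous e) (he : (e : k) ≠ 0) :
    jac (fun i => G * F i) = jac F *
      (Matrix.scalar (Fin d) G + Matrix.vecMulVec (C (σ := Fin d) (e : k)⁻¹ • X) fun j => pderiv j G) := by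
  have hA := smul_jac_mulVec_X hF he
  rw [Matrix.smul_mulVec, ← Matrix.mulVec_smul] at hA
  rw [mul_add, Matrix.mul_vecMulVec, hA]
  ext1 i j
  simp [jac, Matrix.vecMulVec_apply, Derivation.leibniz, mul_comm]

theorem det_jac_mul (hd : 0 < d) {G : MvPolynomial (Fin d) k} {g : ℕ} (hG : G.IsHomogeneous g)
    {F : Fin d → MvPolynomial (Fin d) k} {e : ℕ}
    (hF : ∀ i, (F i).IsHomogeneous e) (he : (e : k) ≠ 0) :
    (jac fun i => G * F i).det = C ((e : k)⁻¹ * (e + g : ℕ)) * (G ^ d * (jac F).det) := by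
  have hdot : (X : Fin d → MvPolynomial (Fin d) k) ⬝ᵥ (fun j => pderiv j G) = C (g : k) * G := by
    rw [map_natCast, ← nsmul_eq_mul]
    exact hG.sum_X_mul_pderiv
  rw [jac_mul_eq hF he, Matrix.det_mul, det_scalar_add_vecMulVec hd, smul_dotProduct, hdot]
  have h1 : (C (e : k)⁻¹ * C (e : k) : MvPolynomial (Fin d) k) = 1 := by
    rw [← map_mul, inv_mul_cancel₀ he, map_one]
  have h2 : G ^ d = G ^ (d - 1) * G := by rw [← pow_succ, Nat.sub_add_cancel hd]
  rw [h2, map_mul, Nat.cast_add, map_add, smul_eq_mul]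
  linear_combination -((jac F).det * G ^ (d - 1) * G) * h1

/-- Two distinct variables are coprime, which is where `2 ≤ d` enters. -/
theorem dvd_of_forall_dvd_X_mul {H a : MvPolynomial (Fin d) k} (hd : 2 ≤ d) (hH : H ≠ 0)
    (h : ∀ j, H ∣ X j * a) : H ∣ a := by
  obtain ⟨b, hb⟩ := h ⟨0, by omega⟩
  obtain ⟨c, hc⟩ := h ⟨1, by omega⟩
  have hbc : X ⟨1, by omega⟩ * b = X ⟨0, by omega⟩ * c := by
    refine mul_left_cancel₀ hH ?_
    linear_combination X ⟨0, by omega⟩ * hc - X ⟨1, by omega⟩ * hb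
  obtain h01 | ⟨b', rfl⟩ := (X_prime (R := k) (i := (⟨0, by omega⟩ : Fin d))).dvd_or_dvd
    (Dvd.intro _ hbc.symm)
  · simp [X_dvd_X] at h01
  · exact ⟨b', mul_left_cancel₀ (X_ne_zero _) (hb.trans (mul_left_comm _ _ _))⟩

theorem socle_quotient_eq_span_singleton {Q : Ideal (MvPolynomial (Fin d) k)}
    {D : MvPolynomial (Fin d) k} (h : ∀ a, (∀ j, X j * a ∈ Q) ↔ a ∈ Q ⊔ Ideal.span {D}) :
    socle k d (MvPolynomial (Fin d) k ⧸ Q) =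
      Submodule.span (MvPolynomial (Fin d) k) {Ideal.Quotient.mk Q D} := by
  ext z
  obtain ⟨a, rfl⟩ := Ideal.Quotient.mk_surjective z
  have h1 : Ideal.Quotient.mk Q a ∈ socle k d (MvPolynomial (Fin d) k ⧸ Q) ↔ ∀ j, X j * a ∈ Q := by
    rw [socle, irrelevantIdeal, ← Submodule.torsionBySet_eq_torsionBySet_span, Submodule.mem_torsionBySet_iff]
    simp only [Subtype.forall, Set.forall_mem_range, ← Ideal.Quotient.eq_zero_iff_mem]
    rfl
  have h2 : Ideal.Quotient.mk Q a ∈ Submodule.span (MvPolynomial (Fin d) k) {Ideal.Quotient.mk Q D} ↔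
      a ∈ Q ⊔ Ideal.span {D} := by
    rw [Submodule.mem_span_singleton, Submodule.mem_sup]
    constructor
    · rintro ⟨r, hr⟩
      exact ⟨a - r * D, Ideal.Quotient.eq.1 hr.symm, r * D,
        Ideal.mul_mem_left _ _ (Ideal.mem_span_singleton_self _), sub_add_cancel _ _⟩
    · rintro ⟨y, hy, w, hw, rfl⟩
      obtain ⟨r, rfl⟩ := Ideal.mem_span_singleton'.1 hw
      exact ⟨r, Ideal.Quotient.eq.2 (by simpa using neg_mem hy)⟩
  rw [h1, h2, h]

theorem forall_X_mul_mem_span_mul_iff (hd : 2 ≤ d) {H D u : MvPolynomial (Fin d) k} (hH : H ≠ 0)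
    (hu : IsUnit u) {Q : Ideal (MvPolynomial (Fin d) k)}
    (h : ∀ a, (∀ j, X j * a ∈ Q) ↔ a ∈ Q ⊔ Ideal.span {D}) (a : MvPolynomial (Fin d) k) :
    (∀ j, X j * a ∈ Ideal.span {H} * Q) ↔
      a ∈ Ideal.span {H} * Q ⊔ Ideal.span {u * (H * D)} := by
  have hs : Ideal.span {H} * Q ⊔ Ideal.span {u * (H * D)} = Ideal.span {H} * (Q ⊔ Ideal.span {D}) := by
    rw [Ideal.span_singleton_mul_left_unit hu, Ideal.mul_sup, Ideal.span_singleton_mul_span_singleton]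
  have hmul : ∀ (P : Ideal (MvPolynomial (Fin d) k)) b, H * b ∈ Ideal.span {H} * P ↔ b ∈ P := by
    intro P b
    rw [Ideal.mem_span_singleton_mul]
    exact ⟨fun ⟨z, hz, hzb⟩ => mul_left_cancel₀ hH hzb ▸ hz, fun hb => ⟨b, hb, rfl⟩⟩
  rw [hs]
  by_cases hdvd : H ∣ a
  · obtain ⟨b, rfl⟩ := hdvd
    simp only [mul_left_comm _ H, hmul, h]
  · have hle : ∀ P, Ideal.span {H} * P ≤ Ideal.span {H} := fun P => Ideal.mul_le_left
    refine iff_of_false (fun hj => hdvd (dvd_of_forall_dvd_X_mul hd hH fun j => ?_)) fun ha => hdvd ?_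
    · exact Ideal.mem_span_singleton.1 (hle _ (hj j))
    · exact Ideal.mem_span_singleton.1 (hle _ ha)

end Jacobian

end JacobianSocle

theorem proposition6p5 {k : Type*} [Field k] (d γ δ : ℕ)
    (G : MvPolynomial (Fin d) k) (hG : G.IsHomogeneous γ) (hG0 : G ≠ 0)
    (F : Fin d → MvPolynomial (Fin d) k) (hF : ∀ i, (F i).IsHomogeneous δ)
    (hreg : RingTheory.Sequence.IsRegular (MvPolynomial (Fin d) k) (List.ofFn F))
    (hδ : (δ : k) ≠ 0) (hδγ : ((δ + γ : ℕ) : k) ≠ 0)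
    (I J : Ideal (MvPolynomial (Fin d) k))
    (hI : I = Ideal.span {G})
    (hJ : J = Ideal.span (Set.range fun i => G * F i)) :
    JacobianSocle.socle k d (MvPolynomial (Fin d) k ⧸ (I ^ (d - 1) * J)) =
      Submodule.span (MvPolynomial (Fin d) k)
        {Ideal.Quotient.mk (I ^ (d - 1) * J)
          (JacobianSocle.jac fun i => G * F i).det} := by
  apply JacobianSocle.socle_quotient_eq_span_singleton
  have hGF : ∀ i, (G * F i).IsHomogeneous (δ + γ) := fun i => add_comm γ δ ▸ hG.mul (hF i)
  rcases Nat.lt_or_ge d 2 with hd | hd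
  -- For `d ≤ 1` the power of `I` is trivial and `GF` is itself weakly regular, so the colon formula
  -- applies to it directly in degree `δ + γ`.
  · rw [show d - 1 = 0 by omega, pow_zero, one_mul, hJ]
    refine JacobianSocle.forall_X_mul_mem_iff hGF hδγ ?_
    have hw := hreg.toIsWeaklyRegular
    interval_cases d
    · simp
    · simp only [List.ofFn_succ, List.ofFn_zero,
        RingTheory.Sequence.isWeaklyRegular_singleton_iff] at hw ⊢
      exact (IsSMulRegular.of_ne_zero hG0).mul hw
  · have hQ : I ^ (d - 1) * J = Ideal.span {G ^ d} * Ideal.span (Set.range F) := by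
      have hJ' : J = Ideal.span {G} * Ideal.span (Set.range F) := by
        rw [hJ, Ideal.span_mul_span', Set.singleton_mul, ← Set.range_comp]
        rfl
      rw [hJ', hI, ← mul_assoc, ← pow_succ, Nat.sub_add_cancel (by omega),
        Ideal.span_singleton_pow]
    rw [hQ, JacobianSocle.det_jac_mul (by omega) hG hF hδ]
    exact JacobianSocle.forall_X_mul_mem_span_mul_iff hd (pow_ne_zero d hG0)
      ((IsUnit.mk0 _ (mul_ne_zero (inv_ne_zero hδ) hδγ)).map MvPolynomial.C)
      (JacobianSocle.forall_X_mul_mem_iff hF hδ hreg.toIsWeaklyRegular)
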